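/- Let $n\ge 1$ be an integer, let $B^n=\{x\in\mathbb R^n:\|x\|\le 1\}$ be the closed Euclidean unit ball, and let $-1\le\rho\le 0$. For a measurable function $f:\mathbb R^n\to B^n$ define its noise stability at $\rho$ by \[ \mathrm{Stab}_\rho[f]=\mathbb E\,\langle f(\mathbf x),f(\mathbf y)\rangle , \] where $(\mathbf x,\mathbf y)$ is a pair of $\rho$-correlated standard Gaussian vectors in $\mathbb R^n$, that is, a centred Gaussian vector in $\mathbb R^{2n}$ with covariance matrix $\begin{pmatrix} I_n&\rho I_n\\ \rho I_n&I_n\end{pmatrix}$. Let $f_{\mathrm{opt}}(x)=x/\|x\|$ for $x\ne0$ (and $f_{\mathrm{opt}}(0)=0$). Then for every measurable $f:\mathbb R^n\to B^n$, \[ \mathrm{Stab}_\rho[f]\ \ge\ \mathrm{Stab}_\rho[f_{\mathrm{opt}}]. \] Moreover, if $-1<\rho<0$ and $\mathrm{Stab}_\rho[f]=\mathrm{Stab}_\rho[f_{\mathrm{opt}}]$, then there is an orthogonal $n\times n$ matrix $M$ such that $f(x)=f_{\mathrm{opt}}(Mx)$ for almost every $x\in\mathbb R^n$ with respect to the standard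 Gaussian measure. -/

import Mathlib

open MeasureTheory ProbabilityTheory

noncomputable section

/-- The covariance matrix `[[I, ρ I], [ρ I, I]]` of a pair of `ρ`-correlated Gaussian vectors. -/
def correlationMatrix (n : ℕ) (ρ : ℝ) : Matrix (Fin n ⊕ Fin n) (Fin n ⊕ Fin n) ℝ :=
  Matrix.fromBlocks 1 (ρ • 1) (ρ • 1) 1

/-- For `-1 ≤ ρ ≤ 1` the matrix is a genuine covariance matrix. -/
theorem correlationMatrix_posSemidef (n : ℕ) {ρ : ℝ} (h1 : -1 ≤ ρ) (h2 : ρ ≤ 1) :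
    (correlationMatrix n ρ).PosSemidef := by
  refine Matrix.PosSemidef.of_dotProduct_mulVec_nonneg ?_ ?_
  · simp [correlationMatrix, Matrix.IsHermitian, Matrix.conjTranspose,
      Matrix.fromBlocks_transpose, Matrix.fromBlocks_map]
    ext i j
    by_cases hij : i = j <;> simp [Matrix.one_apply, hij]
  · intro v
    have h : star v ⬝ᵥ (correlationMatrix n ρ).mulVec v
        = ∑ i, (v (Sum.inl i) ^ 2 + 2 * ρ * (v (Sum.inl i) * v (Sum.inr i))
            + v (Sum.inr i) ^ 2) := by
      simp only [correlationMatrix, Matrix.fromBlocks_mulVec, dotProduct, Fintype.sum_sum_type,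
        Sum.elim_inl, Sum.elim_inr, Matrix.one_mulVec, Matrix.smul_mulVec, Pi.add_apply,
        Pi.smul_apply, Function.comp_apply, smul_eq_mul, star_trivial]
      rw [← Finset.sum_add_distrib]
      exact Finset.sum_congr rfl fun i _ => by ring
    rw [h]
    refine Finset.sum_nonneg fun i _ => ?_
    nlinarith [mul_nonneg (by linarith : 0 ≤ 1 + ρ) (sq_nonneg (v (Sum.inl i) + v (Sum.inr i))),
      mul_nonneg (by linarith : 0 ≤ 1 - ρ) (sq_nonneg (v (Sum.inl i) - v (Sum.inr i)))]

/-- The joint law of a pair of `ρ`-correlated Gaussian vectors in `ℝⁿ`: the centred Gaussian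
measure on `ℝⁿ⁺ⁿ` whose covariance matrix is `[[I, ρ I], [ρ I, I]]`. -/
def correlatedGaussian (n : ℕ) (ρ : ℝ) : Measure (EuclideanSpace ℝ (Fin n ⊕ Fin n)) :=
  multivariateGaussian 0 (correlationMatrix n ρ)

/-- The first vector of a pair. -/
def pairFst {n : ℕ} (w : EuclideanSpace ℝ (Fin n ⊕ Fin n)) : EuclideanSpace ℝ (Fin n) :=
  WithLp.toLp 2 fun i => w (Sum.inl i)

/-- The second vector of a pair. -/
def pairSnd {n : ℕ} (w : EuclideanSpace ℝ (Fin n ⊕ Fin n)) : EuclideanSpace ℝ (Fin n) :=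
  WithLp.toLp 2 fun i => w (Sum.inr i)

/-- The noise stability `Stab_ρ[f] = 𝔼 ⟨f(x), f(y)⟩` of a vector-valued function, where `(x, y)`
is a pair of `ρ`-correlated Gaussian vectors. -/
def noiseStability {n k : ℕ} (ρ : ℝ) (f : EuclideanSpace ℝ (Fin n) → EuclideanSpace ℝ (Fin k)) :
    ℝ :=
  ∫ w, inner ℝ (f (pairFst w)) (f (pairSnd w)) ∂(correlatedGaussian n ρ)

/-- The function `f_opt(x) = x / ‖x‖` (with value `0` at the origin, a null set for `n ≥ 1`). -/
def fOpt {n : ℕ} (x : EuclideanSpace ℝ (Fin n)) : EuclideanSpace ℝ (Fin n) :=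
  ‖x‖⁻¹ • x

end

/-! For `-1 < ρ` the pair has a density K, so noise stability is the sum over the coordinates g of
`f` of the quadratic form B(g) = ∬ g(x) g(y) K(x,y). With w = `radialWeight ρ`, a function of the
radius alone, the stability of `fOpt` is -∫ w. It therefore suffices that w ≥ 0 almost everywhere
and that B(g) + ∫ w g² ≥ 0 for every bounded g (`stabilityDeficit_nonneg`): summing over coordinates
gives Stab f ≥ -∫ w ‖f‖² ≥ -∫ w.

The scalar inequality is proved by parity. The deficit is additive over the even and odd parts of g
under a coordinate reflection (`stabilityDeficit_add`), so g can be peeled one coordinate at a time.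
A part odd in coordinate j is handled by a Schur test (`stabilityDeficit_of_odd`): K(x, R_j y) -
K(x,y) has the sign of x_j y_j, and integrating it against the j-th coordinate of `fOpt` reproduces
that coordinate times 2w, so the deficit is the integral of a weighted square. What remains is even
in all coordinates, hence under x ↦ -x, and there B ≥ 0 already (`stabilityDeficit_of_even`).

If ρ < 0 and equality holds, the square vanishes only for multiples of the j-th coordinate of
`fOpt`, and w > 0 kills the even remainder. Hence `f` is a matrix applied to `fOpt`; w > 0 also
forces ‖f‖ = 1, so the matrix is orthogonal. At ρ = -1 there is no density, but y = -x and the bound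
is pointwise. -/

variable {n : ℕ}

/-! ### Gaussian densities. -/

/-- The density of the standard Gaussian measure on `ℝⁿ`. -/
noncomputable def stdGaussianDensity {n : ℕ} (x : EuclideanSpace ℝ (Fin n)) : ℝ :=
  ((2 * Real.pi) ^ ((n : ℝ) / 2))⁻¹ * Real.exp (-(‖x‖ ^ 2 / 2))

/-- The density of a pair of `ρ`-correlated standard Gaussian vectors in `ℝⁿ`. -/
noncomputable def gaussianKernel {n : ℕ} (ρ : ℝ) (x y : EuclideanSpace ℝ (Fin n)) : ℝ :=
  ((2 * Real.pi) ^ ((n : ℝ) / 2))⁻¹ ^ 2 * (Real.sqrt (1 - ρ ^ 2) ^ n)⁻¹ *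
    Real.exp (-((‖x‖ ^ 2 - 2 * ρ * inner ℝ x y + ‖y‖ ^ 2) / (2 * (1 - ρ ^ 2))))

theorem stdGaussianDensity_nonneg (x : EuclideanSpace ℝ (Fin n)) : 0 ≤ stdGaussianDensity x := by
  unfold stdGaussianDensity; positivity

@[fun_prop]
theorem measurable_stdGaussianDensity :
    Measurable (stdGaussianDensity : EuclideanSpace ℝ (Fin n) → ℝ) := by
  unfold stdGaussianDensity; fun_prop

theorem integrable_stdGaussianDensity :
    Integrable (stdGaussianDensity : EuclideanSpace ℝ (Fin n) → ℝ) := by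
  have h := GaussianFourier.integrable_cexp_neg_mul_sq_norm_add (b := 1 / 2) (by norm_num) 0
    (0 : EuclideanSpace ℝ (Fin n))
  have h2 := h.re.const_mul ((2 * Real.pi) ^ ((n : ℝ) / 2))⁻¹
  refine h2.congr (Filter.Eventually.of_forall fun x => ?_)
  have : (-(1 / 2 : ℂ) * (‖x‖ : ℂ) ^ 2 + 0 * (inner ℝ (0 : EuclideanSpace ℝ (Fin n)) x : ℝ))
      = ((-(‖x‖ ^ 2 / 2) : ℝ) : ℂ) := by
    push_cast; ring
  simp only [this, stdGaussianDensity]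
  rw [← Complex.ofReal_exp]
  rfl

theorem stdGaussian_eq_withDensity :
    stdGaussian (EuclideanSpace ℝ (Fin n)) =
      volume.withDensity fun x => ENNReal.ofReal (stdGaussianDensity x) := by
  have : IsFiniteMeasure ((volume : Measure (EuclideanSpace ℝ (Fin n))).withDensity
      fun x => ENNReal.ofReal (stdGaussianDensity x)) :=
    isFiniteMeasure_withDensity_ofReal integrable_stdGaussianDensity.2
  refine Measure.ext_of_charFun (funext fun t => ?_)
  rw [charFun_stdGaussian, charFun_apply,
    integral_withDensity_eq_integral_toReal_smul (by fun_prop) (by simp)]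
  have h := GaussianFourier.integral_cexp_neg_mul_sq_norm_add (b := 1 / 2) (by norm_num) Complex.I t
  have h1 : ∀ x : EuclideanSpace ℝ (Fin n), (ENNReal.ofReal (stdGaussianDensity x)).toReal •
      Complex.exp ((inner ℝ x t : ℝ) * Complex.I) =
      (((2 * Real.pi) ^ ((n : ℝ) / 2))⁻¹ : ℝ) *
        Complex.exp (-(1 / 2 : ℂ) * ‖x‖ ^ 2 + Complex.I * (inner ℝ t x : ℝ)) := by
    intro x
    rw [ENNReal.toReal_ofReal (stdGaussianDensity_nonneg x), stdGaussianDensity,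
      Complex.real_smul, Complex.ofReal_mul, Complex.ofReal_exp, mul_assoc, ← Complex.exp_add,
      real_inner_comm]
    congr 2
    push_cast; ring
  simp_rw [h1]
  rw [integral_const_mul, h]
  have h2 : ((Real.pi : ℂ) / (1 / 2)) ^
      ((Module.finrank ℝ (EuclideanSpace ℝ (Fin n)) : ℂ) / 2) =
      (((2 * Real.pi) ^ ((n : ℝ) / 2) : ℝ) : ℂ) := by
    rw [Complex.ofReal_cpow (by positivity)]
    simp; ring_nf
  rw [h2, ← mul_assoc, ← Complex.ofReal_mul, inv_mul_cancel₀ (by positivity)]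
  simp
  ring_nf

theorem measurable_gaussianKernel (ρ : ℝ) :
    Measurable fun p : EuclideanSpace ℝ (Fin n) × EuclideanSpace ℝ (Fin n) =>
      gaussianKernel ρ p.1 p.2 := by
  unfold gaussianKernel; fun_prop

theorem gaussianKernel_pos {ρ : ℝ} (h1 : -1 < ρ) (h2 : ρ ≤ 0) (x y : EuclideanSpace ℝ (Fin n)) :
    0 < gaussianKernel ρ x y := by
  have : 0 < 1 - ρ ^ 2 := by nlinarith
  unfold gaussianKernel; positivity

/-- Given x, the vector y is Gaussian with mean ρx and covariance (1 - ρ²)I: the joint density is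
the marginal times this conditional density. -/
theorem stdGaussianDensity_mul_eq_gaussianKernel {ρ : ℝ} (h1 : -1 < ρ) (h2 : ρ ≤ 0)
    (x y : EuclideanSpace ℝ (Fin n)) :
    stdGaussianDensity x * ((Real.sqrt (1 - ρ ^ 2) ^ n)⁻¹ *
      stdGaussianDensity ((Real.sqrt (1 - ρ ^ 2))⁻¹ • (y - ρ • x))) = gaussianKernel ρ x y := by
  have h : 0 < 1 - ρ ^ 2 := by nlinarith
  unfold stdGaussianDensity gaussianKernel
  rw [norm_smul, mul_pow, norm_sub_sq_real, norm_smul, mul_pow, real_inner_smul_right,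
    Real.norm_eq_abs, Real.norm_eq_abs, sq_abs, sq_abs, inv_pow, Real.sq_sqrt h.le,
    real_inner_comm]
  have : -((‖x‖ ^ 2 - 2 * ρ * inner ℝ x y + ‖y‖ ^ 2) / (2 * (1 - ρ ^ 2))) =
      -(‖x‖ ^ 2 / 2) + -((1 - ρ ^ 2)⁻¹ *
        (‖y‖ ^ 2 - 2 * (ρ * inner ℝ x y) + ρ ^ 2 * ‖x‖ ^ 2) / 2) := by
    field_simp
    ring
  rw [this, Real.exp_add]
  ring

/-! ### The law of a correlated pair. -/

/-- Two vectors as one. -/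
noncomputable def gluePair (p : EuclideanSpace ℝ (Fin n) × EuclideanSpace ℝ (Fin n)) :
    EuclideanSpace ℝ (Fin n ⊕ Fin n) :=
  WithLp.toLp 2 (Sum.elim p.1 p.2)

@[simp] theorem pairFst_gluePair (p : EuclideanSpace ℝ (Fin n) × EuclideanSpace ℝ (Fin n)) :
    pairFst (gluePair p) = p.1 := rfl

@[simp] theorem pairSnd_gluePair (p : EuclideanSpace ℝ (Fin n) × EuclideanSpace ℝ (Fin n)) :
    pairSnd (gluePair p) = p.2 := rfl

@[fun_prop]
theorem measurable_gluePair : Measurable (gluePair (n := n)) := by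
  unfold gluePair
  refine (MeasurableEquiv.toLp 2 _).measurable.comp ?_
  refine measurable_pi_iff.2 fun i => ?_
  rcases i with i | i
  · simp; fun_prop
  · simp; fun_prop

@[fun_prop]
theorem measurable_pairFst : Measurable (pairFst (n := n)) := by
  unfold pairFst
  refine (MeasurableEquiv.toLp 2 _).measurable.comp ?_
  exact measurable_pi_iff.2 fun i => by fun_prop

@[fun_prop]
theorem measurable_pairSnd : Measurable (pairSnd (n := n)) := by
  unfold pairSnd
  refine (MeasurableEquiv.toLp 2 _).measurable.comp ?_
  exact measurable_pi_iff.2 fun i => by fun_prop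

theorem inner_gluePair (p : EuclideanSpace ℝ (Fin n) × EuclideanSpace ℝ (Fin n))
    (t : EuclideanSpace ℝ (Fin n ⊕ Fin n)) :
    inner ℝ (gluePair p) t = inner ℝ p.1 (pairFst t) + inner ℝ p.2 (pairSnd t) := by
  simp [PiLp.inner_apply, gluePair, pairFst, pairSnd, Fintype.sum_sum_type]

theorem charFun_correlatedGaussian {ρ : ℝ} (h1 : -1 ≤ ρ) (h2 : ρ ≤ 1)
    (t : EuclideanSpace ℝ (Fin n ⊕ Fin n)) :
    charFun (correlatedGaussian n ρ) t =
      Complex.exp (-((‖pairFst t‖ ^ 2 + 2 * ρ * inner ℝ (pairFst t) (pairSnd t) +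
        ‖pairSnd t‖ ^ 2 : ℝ) : ℂ) / 2) := by
  rw [correlatedGaussian, charFun_multivariateGaussian (correlationMatrix_posSemidef n h1 h2)]
  have : t.ofLp ⬝ᵥ (correlationMatrix n ρ).mulVec t.ofLp =
      ‖pairFst t‖ ^ 2 + 2 * ρ * inner ℝ (pairFst t) (pairSnd t) + ‖pairSnd t‖ ^ 2 := by
    simp only [correlationMatrix, Matrix.fromBlocks_mulVec, dotProduct, Fintype.sum_sum_type,
      Sum.elim_inl, Sum.elim_inr, Matrix.one_mulVec, Matrix.smul_mulVec, Pi.add_apply,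
      Pi.smul_apply, Function.comp_apply, smul_eq_mul, EuclideanSpace.real_norm_sq_eq,
      PiLp.inner_apply, pairFst, pairSnd, Finset.mul_sum]
    simp only [← Finset.sum_add_distrib]
    refine Finset.sum_congr rfl fun i _ => ?_
    simp
    ring
  simp only [inner_zero_right, Complex.ofReal_zero, zero_mul, zero_sub]
  rw [← this]
  congr 1
  simp
  ring

/-- A pair of `ρ`-correlated Gaussian vectors as linear combinations of independent ones. -/
theorem correlatedGaussian_eq_map {ρ a₁ b₁ a₂ b₂ : ℝ} (h1 : -1 ≤ ρ) (h2 : ρ ≤ 1)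
    (ha : a₁ ^ 2 + b₁ ^ 2 = 1) (hb : a₂ ^ 2 + b₂ ^ 2 = 1) (hab : a₁ * a₂ = ρ) :
    correlatedGaussian n ρ =
      ((stdGaussian (EuclideanSpace ℝ (Fin n))).prod
        ((stdGaussian (EuclideanSpace ℝ (Fin n))).prod
          (stdGaussian (EuclideanSpace ℝ (Fin n))))).map
        fun p => gluePair (a₁ • p.1 + b₁ • p.2.1, a₂ • p.1 + b₂ • p.2.2) := by
  have : IsFiniteMeasure (correlatedGaussian n ρ) := by
    unfold correlatedGaussian; infer_instance
  refine Measure.ext_of_charFun (funext fun t => ?_)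
  rw [charFun_correlatedGaussian h1 h2, charFun_apply, integral_map (by fun_prop) (by fun_prop)]
  have h3 : ∀ p : EuclideanSpace ℝ (Fin n) × EuclideanSpace ℝ (Fin n) × EuclideanSpace ℝ (Fin n),
      Complex.exp ((inner ℝ (gluePair (a₁ • p.1 + b₁ • p.2.1, a₂ • p.1 + b₂ • p.2.2)) t : ℝ) *
        Complex.I) =
      Complex.exp ((inner ℝ p.1 (a₁ • pairFst t + a₂ • pairSnd t) : ℝ) * Complex.I) *
      (Complex.exp ((inner ℝ p.2.1 (b₁ • pairFst t) : ℝ) * Complex.I) *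
       Complex.exp ((inner ℝ p.2.2 (b₂ • pairSnd t) : ℝ) * Complex.I)) := by
    intro p
    rw [← Complex.exp_add, ← Complex.exp_add, inner_gluePair]
    simp only [inner_add_left, inner_add_right, real_inner_smul_left, real_inner_smul_right]
    push_cast
    congr 1
    ring
  simp_rw [h3]
  rw [integral_prod_mul (μ := stdGaussian (EuclideanSpace ℝ (Fin n)))
    (ν := (stdGaussian (EuclideanSpace ℝ (Fin n))).prod (stdGaussian (EuclideanSpace ℝ (Fin n))))
    (fun x => Complex.exp ((inner ℝ x (a₁ • pairFst t + a₂ • pairSnd t) : ℝ) * Complex.I))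
    (fun q => Complex.exp ((inner ℝ q.1 (b₁ • pairFst t) : ℝ) * Complex.I) *
       Complex.exp ((inner ℝ q.2 (b₂ • pairSnd t) : ℝ) * Complex.I)),
    integral_prod_mul (μ := stdGaussian (EuclideanSpace ℝ (Fin n)))
    (ν := stdGaussian (EuclideanSpace ℝ (Fin n)))
    (fun x => Complex.exp ((inner ℝ x (b₁ • pairFst t) : ℝ) * Complex.I))
    (fun x => Complex.exp ((inner ℝ x (b₂ • pairSnd t) : ℝ) * Complex.I)),
    ← charFun_apply, ← charFun_apply, ← charFun_apply, charFun_stdGaussian, charFun_stdGaussian,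
    charFun_stdGaussian, ← Complex.exp_add, ← Complex.exp_add]
  congr 1
  -- The three independent factors contribute the squares on the right; the relations on the
  -- coefficients make them add up to the covariance form.
  have h4 : ‖pairFst t‖ ^ 2 + 2 * ρ * inner ℝ (pairFst t) (pairSnd t) + ‖pairSnd t‖ ^ 2 =
      ‖a₁ • pairFst t + a₂ • pairSnd t‖ ^ 2 + ‖b₁ • pairFst t‖ ^ 2 + ‖b₂ • pairSnd t‖ ^ 2 := by
    rw [norm_add_sq_real, norm_smul, norm_smul, norm_smul, norm_smul, real_inner_smul_left,
      real_inner_smul_right]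
    simp only [mul_pow, Real.norm_eq_abs, sq_abs]
    linear_combination -(2 * inner ℝ (pairFst t) (pairSnd t)) * hab - ‖pairFst t‖ ^ 2 * ha
      - ‖pairSnd t‖ ^ 2 * hb
  rw [h4]
  push_cast
  ring

/-- The joint law of a pair of `ρ`-correlated Gaussian vectors has density `gaussianKernel ρ`. -/
theorem map_correlatedGaussian_eq_withDensity {ρ : ℝ} (h1 : -1 < ρ) (h2 : ρ ≤ 0) :
    (correlatedGaussian n ρ).map (fun w => (pairFst w, pairSnd w)) =
      ((volume : Measure (EuclideanSpace ℝ (Fin n))).prod volume).withDensity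
        fun p => ENNReal.ofReal (gaussianKernel ρ p.1 p.2) := by
  have hs : 0 < 1 - ρ ^ 2 := by nlinarith
  have hs' := Real.sqrt_pos.2 hs
  set σ := Real.sqrt (1 - ρ ^ 2) with hσ
  have hm := measurable_gaussianKernel (n := n) ρ
  refine Measure.ext_of_lintegral _ fun F hF => ?_
  -- These coefficients realise the pair as (x, ρx + σz) with z independent of x; the third Gaussian
  -- integrates out.
  rw [lintegral_map hF (by fun_prop), correlatedGaussian_eq_map (a₁ := 1) (b₁ := 0) (a₂ := ρ)
    (b₂ := σ) h1.le (by linarith) (by norm_num) (by rw [hσ, Real.sq_sqrt hs.le]; ring) (by ring),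
    lintegral_map (by fun_prop) (by fun_prop),
    lintegral_withDensity_eq_lintegral_mul _ (by fun_prop) hF,
    lintegral_prod _ (by fun_prop), lintegral_prod _ (by fun_prop)]
  simp only [pairFst_gluePair, pairSnd_gluePair, one_smul, zero_smul, add_zero]
  have h3 : ∀ x : EuclideanSpace ℝ (Fin n),
      ∫⁻ y : EuclideanSpace ℝ (Fin n) × EuclideanSpace ℝ (Fin n), F (x, ρ • x + σ • y.2)
        ∂((stdGaussian _).prod (stdGaussian _)) =
      ∫⁻ z, F (x, ρ • x + σ • z) ∂(stdGaussian (EuclideanSpace ℝ (Fin n))) := by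
    intro x
    rw [lintegral_prod _ (by fun_prop)]
    simp
  simp_rw [h3]
  rw [stdGaussian_eq_withDensity, lintegral_withDensity_eq_lintegral_mul _ (by fun_prop)]
  swap
  · exact Measurable.lintegral_prod_right' (f := fun q : EuclideanSpace ℝ (Fin n) ×
      EuclideanSpace ℝ (Fin n) => F (q.1, ρ • q.1 + σ • q.2)) (by fun_prop)
  refine lintegral_congr fun x => ?_
  simp only [Pi.mul_apply]
  rw [lintegral_withDensity_eq_lintegral_mul _ (by fun_prop) (by fun_prop)]
  set G : EuclideanSpace ℝ (Fin n) → ENNReal := fun y =>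
    ENNReal.ofReal (stdGaussianDensity (σ⁻¹ • (y - ρ • x))) * F (x, y) with hG
  have hGm : Measurable G := by fun_prop
  have h4 : ∀ z, ENNReal.ofReal (stdGaussianDensity z) * F (x, ρ • x + σ • z) =
      (fun w => G (ρ • x + w)) (σ • z) := by
    intro z
    simp [hG, smul_smul, inv_mul_cancel₀ hs'.ne']
  simp only [Pi.mul_apply, h4]
  -- Change of variables y = ρx + σz: the scaling produces the factor σ⁻ⁿ, the translation none.
  rw [← lintegral_map (f := fun w => G (ρ • x + w)) (g := fun z => σ • z) (by fun_prop)
    (by fun_prop), Measure.map_addHaar_smul _ hs'.ne', lintegral_smul_measure,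
    lintegral_add_left_eq_self G, hG, smul_eq_mul, ← mul_assoc, ← lintegral_const_mul _ (by fun_prop)]
  refine lintegral_congr fun y => ?_
  rw [← stdGaussianDensity_mul_eq_gaussianKernel h1 h2, ← hσ, ← mul_assoc,
    ENNReal.ofReal_mul (stdGaussianDensity_nonneg x), ENNReal.ofReal_mul (by positivity),
    abs_of_pos (by positivity)]
  simp [mul_assoc]

/-- The total mass is that of a pushforward of a finite measure. -/
theorem integrable_gaussianKernel {ρ : ℝ} (h1 : -1 < ρ) (h2 : ρ ≤ 0) :
    Integrable (fun p : EuclideanSpace ℝ (Fin n) × EuclideanSpace ℝ (Fin n) =>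
      gaussianKernel ρ p.1 p.2) (volume.prod volume) := by
  refine ⟨(measurable_gaussianKernel ρ).aestronglyMeasurable, ?_⟩
  rw [hasFiniteIntegral_iff_ofReal
    (Filter.Eventually.of_forall fun p => (gaussianKernel_pos h1 h2 _ _).le)]
  have h := congrArg (fun μ => μ Set.univ) (map_correlatedGaussian_eq_withDensity (n := n) h1 h2)
  simp only [withDensity_apply _ MeasurableSet.univ, Measure.restrict_univ] at h
  rw [← h]
  have : IsFiniteMeasure (correlatedGaussian n ρ) := by
    unfold correlatedGaussian; infer_instance
  exact measure_lt_top _ _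

theorem integral_correlatedGaussian {ρ : ℝ} (h1 : -1 < ρ) (h2 : ρ ≤ 0)
    {F : EuclideanSpace ℝ (Fin n) × EuclideanSpace ℝ (Fin n) → ℝ} (hF : Measurable F) :
    ∫ w, F (pairFst w, pairSnd w) ∂(correlatedGaussian n ρ) =
      ∫ p, F p * gaussianKernel ρ p.1 p.2 ∂(volume.prod volume) := by
  have hm := measurable_gaussianKernel (n := n) ρ
  rw [← integral_map (f := F) (φ := fun w => (pairFst w, pairSnd w)) (by fun_prop) (by fun_prop),
    map_correlatedGaussian_eq_withDensity h1 h2,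
    integral_withDensity_eq_integral_toReal_smul (by fun_prop) (by simp)]
  refine integral_congr_ae (Filter.Eventually.of_forall fun p => ?_)
  simp only [ENNReal.toReal_ofReal (gaussianKernel_pos h1 h2 _ _).le, smul_eq_mul]
  ring

/-- The noise stability of an even function at a negative correlation is nonnegative. -/
theorem integral_correlatedGaussian_even_nonneg {ρ : ℝ} (h1 : -1 ≤ ρ) (h2 : ρ ≤ 0)
    {g : EuclideanSpace ℝ (Fin n) → ℝ} (hg : Measurable g) {C : ℝ} (hC : ∀ x, |g x| ≤ C)
    (heven : ∀ x, g (-x) = g x) :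
    0 ≤ ∫ w, g (pairFst w) * g (pairSnd w) ∂(correlatedGaussian n ρ) := by
  -- The pair is realised as x = sa + σb, y = -(sa + σc), with cross-covariance -s² = ρ. Evenness
  -- removes the sign of y, and conditionally on a the two factors are independent with the same
  -- law, so the inner integral is a square.
  set s := Real.sqrt (-ρ)
  set σ := Real.sqrt (1 + ρ)
  have hs : s ^ 2 = -ρ := Real.sq_sqrt (by linarith)
  have hσ : σ ^ 2 = 1 + ρ := Real.sq_sqrt (by linarith)
  rw [correlatedGaussian_eq_map (a₁ := s) (b₁ := σ) (a₂ := -s) (b₂ := -σ) h1 (by linarith)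
    (by linarith) (by nlinarith) (by nlinarith), integral_map (by fun_prop) (by fun_prop)]
  simp only [pairFst_gluePair, pairSnd_gluePair]
  have h3 : ∀ a b : EuclideanSpace ℝ (Fin n), g (-s • a + -σ • b) = g (s • a + σ • b) := by
    intro a b
    rw [← heven]; congr 1; simp; abel
  simp_rw [h3]
  rw [integral_prod]
  · refine integral_nonneg fun w => ?_
    simp only [Pi.zero_apply]
    rw [integral_prod_mul (fun z => g (s • w + σ • z)) (fun z => g (s • w + σ • z))]
    exact mul_self_nonneg _
  · refine Integrable.of_bound (by fun_prop) (C * C) (Filter.Eventually.of_forall fun p => ?_)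
    rw [Real.norm_eq_abs, abs_mul]
    exact mul_le_mul (hC _) (hC _) (abs_nonneg _) ((abs_nonneg _).trans (hC 0))

/-! ### Coordinate reflections. -/

/-- The reflection changing the sign of the `j`-th coordinate. -/
noncomputable def coordReflection (j : Fin n) :
    EuclideanSpace ℝ (Fin n) ≃ₗᵢ[ℝ] EuclideanSpace ℝ (Fin n) :=
  (ℝ ∙ (EuclideanSpace.single j (1 : ℝ)))ᗮ.reflection

theorem coordReflection_eq (j : Fin n) (x : EuclideanSpace ℝ (Fin n)) :
    coordReflection j x = x - (2 * x j) • EuclideanSpace.single j (1 : ℝ) := by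
  rw [coordReflection, Submodule.reflection_orthogonal_apply, Submodule.reflection_singleton_apply]
  simp [EuclideanSpace.inner_single_left, two_smul, add_smul, two_mul]

theorem coordReflection_apply (j : Fin n) (x : EuclideanSpace ℝ (Fin n)) (i : Fin n) :
    coordReflection j x i = if i = j then -x i else x i := by
  rw [coordReflection_eq]
  split_ifs with h
  · subst h; simp; ring
  · simp [h]

theorem coordReflection_apply_self (j : Fin n) (x : EuclideanSpace ℝ (Fin n)) :
    coordReflection j x j = -x j := by
  simp [coordReflection_apply]

@[simp] theorem coordReflection_coordReflection (j : Fin n) (x : EuclideanSpace ℝ (Fin n)) :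
    coordReflection j (coordReflection j x) = x :=
  Submodule.reflection_reflection _ x

theorem coordReflection_comm (i j : Fin n) (x : EuclideanSpace ℝ (Fin n)) :
    coordReflection i (coordReflection j x) = coordReflection j (coordReflection i x) := by
  ext k
  simp only [coordReflection_apply]
  split_ifs <;> rfl

/-- The map x ↦ -x is the product of all coordinate reflections; the signs are flipped one
coordinate at a time. -/
theorem apply_neg_of_coordReflection_invariant {g : EuclideanSpace ℝ (Fin n) → ℝ}
    (h : ∀ j x, g (coordReflection j x) = g x) (x : EuclideanSpace ℝ (Fin n)) :
    g (-x) = g x := by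
  have key : ∀ s : Finset (Fin n),
      g (WithLp.toLp 2 fun i => if i ∈ s then -x i else x i) = g x := by
    intro s
    induction s using Finset.induction_on with
    | empty => simp
    | insert a s ha ih =>
      rw [← ih, ← h a]
      congr 1
      ext i
      simp only [coordReflection_apply, Finset.mem_insert]
      by_cases hi : i = a
      · subst hi; simp [ha]
      · simp [hi]
  have := key Finset.univ
  rw [← this]
  congr 1
  ext i
  simp

/-! ### The normalised vector and its coordinates. -/

@[fun_prop]
theorem measurable_fOpt : Measurable (fOpt (n := n)) := by
  unfold fOpt; fun_prop

theorem norm_fOpt_le (x : EuclideanSpace ℝ (Fin n)) : ‖fOpt x‖ ≤ 1 := by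
  rw [fOpt, norm_smul, norm_inv, norm_norm]
  exact inv_mul_le_one

theorem abs_fOpt_apply_le (x : EuclideanSpace ℝ (Fin n)) (j : Fin n) : |fOpt x j| ≤ 1 :=
  (PiLp.norm_apply_le (fOpt x) j).trans (norm_fOpt_le x)

theorem fOpt_map (R : EuclideanSpace ℝ (Fin n) ≃ₗᵢ[ℝ] EuclideanSpace ℝ (Fin n))
    (x : EuclideanSpace ℝ (Fin n)) : fOpt (R x) = R (fOpt x) := by
  simp [fOpt]

theorem fOpt_apply (x : EuclideanSpace ℝ (Fin n)) (j : Fin n) : fOpt x j = ‖x‖⁻¹ * x j := by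
  simp [fOpt]

theorem fOpt_apply_ne_zero {x : EuclideanSpace ℝ (Fin n)} {j : Fin n} (h : x j ≠ 0) :
    fOpt x j ≠ 0 := by
  rw [fOpt_apply]
  have : x ≠ 0 := by rintro rfl; simp at h
  positivity

theorem norm_fOpt {x : EuclideanSpace ℝ (Fin n)} (h : x ≠ 0) : ‖fOpt x‖ = 1 := by
  rw [fOpt, norm_smul, norm_inv, norm_norm, inv_mul_cancel₀ (norm_ne_zero_iff.2 h)]

theorem ae_apply_ne_zero (j : Fin n) : ∀ᵐ x : EuclideanSpace ℝ (Fin n), x j ≠ 0 := by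
  have h := Measure.addHaar_submodule (volume : Measure (EuclideanSpace ℝ (Fin n)))
    (LinearMap.ker (EuclideanSpace.proj j : EuclideanSpace ℝ (Fin n) →L[ℝ] ℝ).toLinearMap) (by
      intro h
      have : EuclideanSpace.single j (1 : ℝ) ∈ (⊤ : Submodule ℝ (EuclideanSpace ℝ (Fin n))) :=
        trivial
      rw [← h] at this
      simp at this)
  rw [ae_iff]
  convert h using 2
  ext x
  simp

/-! ### The kernel under reflection of one variable. -/

theorem gaussianKernel_comm (ρ : ℝ) (x y : EuclideanSpace ℝ (Fin n)) :
    gaussianKernel ρ x y = gaussianKernel ρ y x := by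
  unfold gaussianKernel
  rw [real_inner_comm]
  congr 4
  ring

theorem gaussianKernel_map (ρ : ℝ) (R : EuclideanSpace ℝ (Fin n) ≃ₗᵢ[ℝ] EuclideanSpace ℝ (Fin n))
    (x y : EuclideanSpace ℝ (Fin n)) :
    gaussianKernel ρ (R x) (R y) = gaussianKernel ρ x y := by
  simp [gaussianKernel]

/-- The change of the density of a correlated pair under reflection of the second vector. -/
noncomputable def reflectedKernelDiff (ρ : ℝ) (j : Fin n) (x y : EuclideanSpace ℝ (Fin n)) : ℝ :=
  gaussianKernel ρ x (coordReflection j y) - gaussianKernel ρ x y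

theorem measurable_reflectedKernelDiff (ρ : ℝ) (j : Fin n) :
    Measurable fun p : EuclideanSpace ℝ (Fin n) × EuclideanSpace ℝ (Fin n) =>
      reflectedKernelDiff ρ j p.1 p.2 := by
  have h := measurable_gaussianKernel (n := n) ρ
  have h2 : Measurable fun p : EuclideanSpace ℝ (Fin n) × EuclideanSpace ℝ (Fin n) =>
      (p.1, coordReflection j p.2) :=
    measurable_fst.prodMk ((coordReflection j).continuous.measurable.comp measurable_snd)
  exact (h.comp h2).sub h

theorem reflectedKernelDiff_comm (ρ : ℝ) (j : Fin n) (x y : EuclideanSpace ℝ (Fin n)) :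
    reflectedKernelDiff ρ j x y = reflectedKernelDiff ρ j y x := by
  unfold reflectedKernelDiff
  rw [gaussianKernel_comm ρ x y, gaussianKernel_comm ρ x (coordReflection j y),
    ← gaussianKernel_map ρ (coordReflection j) (coordReflection j y) x,
    coordReflection_coordReflection]

theorem inner_coordReflection (j : Fin n) (x y : EuclideanSpace ℝ (Fin n)) :
    inner ℝ x (coordReflection j y) = inner ℝ x y - 2 * (x j * y j) := by
  rw [coordReflection_eq, inner_sub_right, real_inner_smul_right]
  simp [EuclideanSpace.inner_single_right]
  ring

/-- Reflecting y preserves its norm and lowers the inner product by 2 x_j y_j, so the kernel is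
merely multiplied by an exponential. -/
theorem reflectedKernelDiff_eq (ρ : ℝ) (j : Fin n) (x y : EuclideanSpace ℝ (Fin n)) :
    reflectedKernelDiff ρ j x y =
      gaussianKernel ρ x y * (Real.exp (-(2 * ρ * (x j * y j) / (1 - ρ ^ 2))) - 1) := by
  unfold reflectedKernelDiff gaussianKernel
  rw [inner_coordReflection, LinearIsometryEquiv.norm_map]
  have : -((‖x‖ ^ 2 - 2 * ρ * (inner ℝ x y - 2 * (x j * y j)) + ‖y‖ ^ 2) / (2 * (1 - ρ ^ 2))) =
      -((‖x‖ ^ 2 - 2 * ρ * inner ℝ x y + ‖y‖ ^ 2) / (2 * (1 - ρ ^ 2))) +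
        -(2 * ρ * (x j * y j) / (1 - ρ ^ 2)) := by
    rw [mul_comm 2 (1 - ρ ^ 2), ← div_div, ← div_div]
    ring
  rw [this, Real.exp_add]
  ring

/-- For ρ ≤ 0 the exponent in `reflectedKernelDiff_eq` has the sign of x_j y_j or vanishes. This is
where the negative correlation enters the Schur test. -/
theorem mul_reflectedKernelDiff_nonneg {ρ : ℝ} (h1 : -1 < ρ) (h2 : ρ ≤ 0) (j : Fin n)
    (x y : EuclideanSpace ℝ (Fin n)) :
    0 ≤ fOpt x j * fOpt y j * reflectedKernelDiff ρ j x y := by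
  have hs : 0 < 1 - ρ ^ 2 := by nlinarith
  have hk := gaussianKernel_pos h1 h2 x y
  rw [reflectedKernelDiff_eq, fOpt_apply, fOpt_apply]
  have key : 0 ≤ (x j * y j) * (Real.exp (-(2 * ρ * (x j * y j) / (1 - ρ ^ 2))) - 1) := by
    rcases le_total 0 (x j * y j) with h | h
    · refine mul_nonneg h (sub_nonneg.2 (Real.one_le_exp ?_))
      rw [neg_nonneg]
      exact div_nonpos_of_nonpos_of_nonneg (by nlinarith) hs.le
    · refine mul_nonneg_of_nonpos_of_nonpos h (sub_nonpos.2 (Real.exp_le_one_iff.2 ?_))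
      rw [neg_nonpos]
      exact div_nonneg (by nlinarith) hs.le
  calc 0 ≤ ‖x‖⁻¹ * ‖y‖⁻¹ * gaussianKernel ρ x y *
        ((x j * y j) * (Real.exp (-(2 * ρ * (x j * y j) / (1 - ρ ^ 2))) - 1)) := by positivity
    _ = _ := by ring

theorem reflectedKernelDiff_ne_zero {ρ : ℝ} (h1 : -1 < ρ) (h2 : ρ < 0) {j : Fin n}
    {x y : EuclideanSpace ℝ (Fin n)} (hx : x j ≠ 0) (hy : y j ≠ 0) :
    reflectedKernelDiff ρ j x y ≠ 0 := by
  have hs : 0 < 1 - ρ ^ 2 := by nlinarith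
  rw [reflectedKernelDiff_eq]
  refine mul_ne_zero (gaussianKernel_pos h1 h2.le x y).ne' (sub_ne_zero.2 ?_)
  rw [Ne, Real.exp_eq_one_iff]
  have := h2.ne
  have := hs.ne'
  simp [*]

theorem reflectedKernelDiff_eq_zero (ρ : ℝ) {j : Fin n}
    {x y : EuclideanSpace ℝ (Fin n)} (h : x j * y j = 0) : reflectedKernelDiff ρ j x y = 0 := by
  rw [reflectedKernelDiff_eq, h]; simp

theorem integrable_mul_gaussianKernel {ρ : ℝ} (h1 : -1 < ρ) (h2 : ρ ≤ 0)
    {F : EuclideanSpace ℝ (Fin n) × EuclideanSpace ℝ (Fin n) → ℝ} (hF : Measurable F) {C : ℝ}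
    (hC : ∀ p, |F p| ≤ C) :
    Integrable (fun p => F p * gaussianKernel ρ p.1 p.2) (volume.prod volume) :=
  (integrable_gaussianKernel h1 h2).bdd_mul hF.aestronglyMeasurable
    (Filter.Eventually.of_forall hC)

theorem ae_integrable_gaussianKernel {ρ : ℝ} (h1 : -1 < ρ) (h2 : ρ ≤ 0) :
    ∀ᵐ x : EuclideanSpace ℝ (Fin n), Integrable (gaussianKernel ρ x) :=
  (integrable_gaussianKernel h1 h2).prod_right_ae

/-! ### The radial weight and its eigenfunction relation. -/

/-- Minus the eigenvalue of the noise operator on linear functions, at a given radius. -/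
noncomputable def radialWeight (ρ : ℝ) (x : EuclideanSpace ℝ (Fin n)) : ℝ :=
  -∫ y, inner ℝ (fOpt x) (fOpt y) * gaussianKernel ρ x y

theorem abs_inner_fOpt_le (x y : EuclideanSpace ℝ (Fin n)) :
    |inner ℝ (fOpt x) (fOpt y)| ≤ 1 :=
  (abs_real_inner_le_norm _ _).trans
    (mul_le_one₀ (norm_fOpt_le x) (norm_nonneg _) (norm_fOpt_le y))

theorem integrable_radialWeight {ρ : ℝ} (h1 : -1 < ρ) (h2 : ρ ≤ 0) :
    Integrable (radialWeight (n := n) ρ) := by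
  have := integrable_mul_gaussianKernel (n := n) h1 h2
    (F := fun p => inner ℝ (fOpt p.1) (fOpt p.2)) (by fun_prop)
    (fun p => abs_inner_fOpt_le p.1 p.2)
  exact this.integral_prod_left.neg

theorem integral_comp_isometry {F : Type*} [NormedAddCommGroup F] [NormedSpace ℝ F]
    (R : EuclideanSpace ℝ (Fin n) ≃ₗᵢ[ℝ] EuclideanSpace ℝ (Fin n))
    (φ : EuclideanSpace ℝ (Fin n) → F) : ∫ y, φ (R y) = ∫ y, φ y :=
  R.measurePreserving.integral_comp R.toMeasurableEquiv.measurableEmbedding φ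

theorem radialWeight_map (ρ : ℝ) (R : EuclideanSpace ℝ (Fin n) ≃ₗᵢ[ℝ] EuclideanSpace ℝ (Fin n))
    (x : EuclideanSpace ℝ (Fin n)) : radialWeight ρ (R x) = radialWeight ρ x := by
  unfold radialWeight
  rw [← integral_comp_isometry R]
  simp [fOpt_map, gaussianKernel_map]

/-- The integral is invariant under every isometry fixing x, hence lies on the line through x;
pairing with `fOpt x` identifies the coefficient. -/
theorem integral_smul_fOpt_eq {ρ : ℝ} {x : EuclideanSpace ℝ (Fin n)}
    (hx : Integrable (gaussianKernel ρ x)) :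
    ∫ y, gaussianKernel ρ x y • fOpt y = -radialWeight ρ x • fOpt x := by
  set V := ∫ y, gaussianKernel ρ x y • fOpt y with hV
  have hint : Integrable fun y => gaussianKernel ρ x y • fOpt y :=
    hx.smul_bdd 1 measurable_fOpt.aestronglyMeasurable (Filter.Eventually.of_forall norm_fOpt_le)
  -- One such isometry is enough: this one fixes exactly the line spanned by x.
  set R := (ℝ ∙ x).reflection
  have hRx : R x = x := Submodule.reflection_mem_subspace_eq_self
    (Submodule.mem_span_singleton_self x)
  have hRV : R V = V := by
    have h1 : R V = ∫ y, R (gaussianKernel ρ x y • fOpt y) :=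
      (R.toContinuousLinearEquiv.integral_comp_comm _).symm
    rw [h1, hV, ← integral_comp_isometry R (fun y => gaussianKernel ρ x y • fOpt y)]
    refine integral_congr_ae (Filter.Eventually.of_forall fun y => ?_)
    simp only
    rw [fOpt_map, map_smul, ← gaussianKernel_map ρ R x y, hRx]
  obtain ⟨c, hc⟩ := Submodule.mem_span_singleton.1 ((Submodule.reflection_eq_self_iff V).1 hRV)
  have hw : radialWeight ρ x = -inner ℝ (fOpt x) V := by
    rw [hV, ← integral_inner hint, radialWeight]
    congr 2
    ext y
    rw [real_inner_smul_right, mul_comm]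
  rw [hw, neg_neg, ← hc]
  by_cases h0 : x = 0
  · simp [h0]
  · simp only [fOpt, real_inner_smul_left, real_inner_smul_right, real_inner_self_eq_norm_sq,
      smul_smul]
    congr 1
    have := norm_ne_zero_iff.2 h0
    field_simp

theorem integral_fOpt_apply_mul_gaussianKernel {ρ : ℝ} {x : EuclideanSpace ℝ (Fin n)}
    (hx : Integrable (gaussianKernel ρ x)) (j : Fin n) :
    ∫ y, fOpt y j * gaussianKernel ρ x y = -radialWeight ρ x * fOpt x j := by
  have hint : Integrable fun y => gaussianKernel ρ x y • fOpt y :=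
    hx.smul_bdd 1 measurable_fOpt.aestronglyMeasurable (Filter.Eventually.of_forall norm_fOpt_le)
  have h := congrArg (EuclideanSpace.proj j : EuclideanSpace ℝ (Fin n) →L[ℝ] ℝ)
    (integral_smul_fOpt_eq hx)
  rw [← ContinuousLinearMap.integral_comp_comm _ hint] at h
  simpa [mul_comm] using h

theorem integrable_reflectedKernelDiff {ρ : ℝ} {x : EuclideanSpace ℝ (Fin n)}
    (hx : Integrable (gaussianKernel ρ x)) (j : Fin n) :
    Integrable (reflectedKernelDiff ρ j x) :=
  ((coordReflection j).measurePreserving.integrable_comp_of_integrable hx).sub hx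

theorem integrable_fOpt_apply_mul {h : EuclideanSpace ℝ (Fin n) → ℝ} (hh : Integrable h)
    (j : Fin n) : Integrable fun y => fOpt y j * h y :=
  hh.bdd_mul (c := 1) (by fun_prop) (Filter.Eventually.of_forall fun y => abs_fOpt_apply_le y j)

/-- The j-th coordinate of `fOpt` is odd under the reflection, so both halves of the difference
contribute equally. This is the eigenfunction relation behind the Schur test. -/
theorem integral_fOpt_apply_mul_reflectedKernelDiff {ρ : ℝ} {x : EuclideanSpace ℝ (Fin n)}
    (hx : Integrable (gaussianKernel ρ x)) (j : Fin n) :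
    ∫ y, fOpt y j * reflectedKernelDiff ρ j x y = 2 * radialWeight ρ x * fOpt x j := by
  have hx' : Integrable fun y => gaussianKernel ρ x (coordReflection j y) :=
    (coordReflection j).measurePreserving.integrable_comp_of_integrable hx
  have h1 : ∫ y, fOpt y j * gaussianKernel ρ x (coordReflection j y) =
      -∫ y, fOpt y j * gaussianKernel ρ x y := by
    rw [← integral_comp_isometry (coordReflection j), ← integral_neg]
    simp [fOpt_map, coordReflection_apply_self]
  unfold reflectedKernelDiff
  simp_rw [mul_sub]
  rw [integral_sub (integrable_fOpt_apply_mul hx' j) (integrable_fOpt_apply_mul hx j), h1,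
    integral_fOpt_apply_mul_gaussianKernel hx]
  ring

/-- Multiplying the eigenfunction relation by the j-th coordinate of `fOpt x` makes its integrand
nonnegative, while the other side becomes w times a positive square. -/
theorem radialWeight_nonneg {ρ : ℝ} (h1 : -1 < ρ) (h2 : ρ ≤ 0) {x : EuclideanSpace ℝ (Fin n)}
    (hx : Integrable (gaussianKernel ρ x)) {j : Fin n} (hj : x j ≠ 0) : 0 ≤ radialWeight ρ x := by
  have h := integral_fOpt_apply_mul_reflectedKernelDiff hx j
  have h3 : 0 ≤ ∫ y, fOpt x j * fOpt y j * reflectedKernelDiff ρ j x y :=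
    integral_nonneg fun y => mul_reflectedKernelDiff_nonneg h1 h2 j x y
  simp_rw [mul_assoc] at h3
  rw [integral_const_mul, h] at h3
  have := mul_self_pos.2 (fOpt_apply_ne_zero hj)
  nlinarith

theorem radialWeight_pos {ρ : ℝ} (h1 : -1 < ρ) (h2 : ρ < 0) {x : EuclideanSpace ℝ (Fin n)}
    (hx : Integrable (gaussianKernel ρ x)) {j : Fin n} (hj : x j ≠ 0) : 0 < radialWeight ρ x := by
  refine (radialWeight_nonneg h1 h2.le hx hj).lt_of_ne fun h0 => ?_
  have h := integral_fOpt_apply_mul_reflectedKernelDiff hx j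
  have h3 : ∫ y, fOpt x j * (fOpt y j * reflectedKernelDiff ρ j x y) = 0 := by
    rw [integral_const_mul, h, ← h0]; simp
  rw [integral_eq_zero_iff_of_nonneg
    (fun y => by simpa [mul_assoc] using mul_reflectedKernelDiff_nonneg h1 h2.le j x y)
    ((integrable_fOpt_apply_mul (integrable_reflectedKernelDiff hx j) j).const_mul _)] at h3
  obtain ⟨y, hy, hyj⟩ := (h3.and (ae_apply_ne_zero j)).exists
  exact mul_ne_zero (fOpt_apply_ne_zero hj) (mul_ne_zero (fOpt_apply_ne_zero hyj)
    (reflectedKernelDiff_ne_zero h1 h2 hj hyj)) hy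

/-! ### The deficit and the Schur test on odd functions. -/

/-- The noise stability form of `g`, plus its bound by the radial weight. -/
noncomputable def stabilityDeficit (ρ : ℝ) (g : EuclideanSpace ℝ (Fin n) → ℝ) : ℝ :=
  (∫ p : EuclideanSpace ℝ (Fin n) × EuclideanSpace ℝ (Fin n),
    g p.1 * g p.2 * gaussianKernel ρ p.1 p.2 ∂(volume.prod volume)) +
  ∫ x, radialWeight ρ x * g x ^ 2

theorem integrable_radialWeight_mul_sq {ρ : ℝ} (h1 : -1 < ρ) (h2 : ρ ≤ 0)
    {g : EuclideanSpace ℝ (Fin n) → ℝ} (hg : Measurable g) {C : ℝ} (hC : ∀ x, |g x| ≤ C) :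
    Integrable fun x => radialWeight ρ x * g x ^ 2 := by
  refine (integrable_radialWeight h1 h2).mul_bdd (c := C ^ 2) (by fun_prop)
    (Filter.Eventually.of_forall fun x => ?_)
  rw [Real.norm_eq_abs, abs_pow]
  exact pow_le_pow_left₀ (abs_nonneg _) (hC x) 2

theorem abs_mul_le_of_bound {g h : EuclideanSpace ℝ (Fin n) → ℝ} {C D : ℝ} (hC : ∀ x, |g x| ≤ C)
    (hD : ∀ x, |h x| ≤ D) (p : EuclideanSpace ℝ (Fin n) × EuclideanSpace ℝ (Fin n)) :
    |g p.1 * h p.2| ≤ C * D := by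
  rw [abs_mul]
  exact mul_le_mul (hC _) (hD _) (abs_nonneg _) ((abs_nonneg _).trans (hC 0))

/-- The comparison function for the Schur test with the `j`-th coordinate of `fOpt`. -/
noncomputable def schurMajorant (ρ : ℝ) (j : Fin n) (g : EuclideanSpace ℝ (Fin n) → ℝ)
    (p : EuclideanSpace ℝ (Fin n) × EuclideanSpace ℝ (Fin n)) : ℝ :=
  g p.1 ^ 2 * (fOpt p.1 j)⁻¹ * (fOpt p.2 j * reflectedKernelDiff ρ j p.1 p.2)

theorem schurMajorant_nonneg {ρ : ℝ} (h1 : -1 < ρ) (h2 : ρ ≤ 0) (j : Fin n)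
    (g : EuclideanSpace ℝ (Fin n) → ℝ)
    (p : EuclideanSpace ℝ (Fin n) × EuclideanSpace ℝ (Fin n)) : 0 ≤ schurMajorant ρ j g p := by
  have h := mul_reflectedKernelDiff_nonneg h1 h2 j p.1 p.2
  unfold schurMajorant
  by_cases h0 : fOpt p.1 j = 0
  · simp [h0]
  · have : g p.1 ^ 2 * (fOpt p.1 j)⁻¹ * (fOpt p.2 j * reflectedKernelDiff ρ j p.1 p.2) =
        (g p.1 / fOpt p.1 j) ^ 2 * (fOpt p.1 j * fOpt p.2 j * reflectedKernelDiff ρ j p.1 p.2) := by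
      field_simp
    rw [this]
    positivity

theorem measurable_schurMajorant (ρ : ℝ) (j : Fin n) {g : EuclideanSpace ℝ (Fin n) → ℝ}
    (hg : Measurable g) : Measurable (schurMajorant ρ j g) := by
  have := measurable_reflectedKernelDiff (n := n) ρ j
  unfold schurMajorant
  fun_prop

theorem ae_integral_schurMajorant {ρ : ℝ} (h1 : -1 < ρ) (h2 : ρ ≤ 0) (j : Fin n)
    (g : EuclideanSpace ℝ (Fin n) → ℝ) :
    ∀ᵐ x, ∫ y, schurMajorant ρ j g (x, y) = 2 * (radialWeight ρ x * g x ^ 2) := by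
  filter_upwards [ae_integrable_gaussianKernel h1 h2, ae_apply_ne_zero j] with x hx hj
  have := fOpt_apply_ne_zero hj
  simp only [schurMajorant]
  rw [integral_const_mul, integral_fOpt_apply_mul_reflectedKernelDiff hx j]
  field_simp

theorem integrable_schurMajorant {ρ : ℝ} (h1 : -1 < ρ) (h2 : ρ ≤ 0) (j : Fin n)
    {g : EuclideanSpace ℝ (Fin n) → ℝ} (hg : Measurable g) {C : ℝ} (hC : ∀ x, |g x| ≤ C) :
    Integrable (schurMajorant ρ j g) (volume.prod volume) := by
  rw [integrable_prod_iff (measurable_schurMajorant ρ j hg).aestronglyMeasurable]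
  constructor
  · filter_upwards [ae_integrable_gaussianKernel h1 h2] with x hx
    exact (integrable_fOpt_apply_mul (integrable_reflectedKernelDiff hx j) j).const_mul
      (g x ^ 2 * (fOpt x j)⁻¹)
  · refine ((integrable_radialWeight_mul_sq h1 h2 hg hC).const_mul 2).congr ?_
    filter_upwards [ae_integral_schurMajorant h1 h2 j g] with x hx
    rw [← hx]
    simp_rw [Real.norm_of_nonneg (schurMajorant_nonneg h1 h2 j g _)]

theorem integral_schurMajorant {ρ : ℝ} (h1 : -1 < ρ) (h2 : ρ ≤ 0) (j : Fin n)
    {g : EuclideanSpace ℝ (Fin n) → ℝ} (hg : Measurable g) {C : ℝ} (hC : ∀ x, |g x| ≤ C) :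
    ∫ p, schurMajorant ρ j g p ∂(volume.prod volume) = 2 * ∫ x, radialWeight ρ x * g x ^ 2 := by
  rw [integral_prod _ (integrable_schurMajorant h1 h2 j hg hC),
    integral_congr_ae (ae_integral_schurMajorant h1 h2 j g), integral_const_mul]

theorem integral_prod_comp_isometry
    (R S : EuclideanSpace ℝ (Fin n) ≃ₗᵢ[ℝ] EuclideanSpace ℝ (Fin n))
    (φ : EuclideanSpace ℝ (Fin n) × EuclideanSpace ℝ (Fin n) → ℝ) :
    ∫ p, φ (R p.1, S p.2) ∂(volume.prod volume) = ∫ p, φ p ∂(volume.prod volume) :=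
  (R.measurePreserving.prod S.measurePreserving).integral_comp
    (R.toMeasurableEquiv.prodCongr S.toMeasurableEquiv).measurableEmbedding φ

/-- The integrand of the Schur test. -/
noncomputable def schurIntegrand (ρ : ℝ) (j : Fin n) (g : EuclideanSpace ℝ (Fin n) → ℝ)
    (p : EuclideanSpace ℝ (Fin n) × EuclideanSpace ℝ (Fin n)) : ℝ :=
  schurMajorant ρ j g p + schurMajorant ρ j g p.swap -
    2 * (g p.1 * g p.2 * reflectedKernelDiff ρ j p.1 p.2)

/-- Completing the square, using the symmetry of the kernel difference. -/
theorem schurIntegrand_eq (ρ : ℝ) (j : Fin n) (g : EuclideanSpace ℝ (Fin n) → ℝ)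
    {p : EuclideanSpace ℝ (Fin n) × EuclideanSpace ℝ (Fin n)} (hx : p.1 j ≠ 0) (hy : p.2 j ≠ 0) :
    schurIntegrand ρ j g p = fOpt p.1 j * fOpt p.2 j * reflectedKernelDiff ρ j p.1 p.2 *
      (g p.1 / fOpt p.1 j - g p.2 / fOpt p.2 j) ^ 2 := by
  have h3 := fOpt_apply_ne_zero hx
  have h4 := fOpt_apply_ne_zero hy
  simp only [schurIntegrand, schurMajorant, Prod.fst_swap, Prod.snd_swap]
  rw [reflectedKernelDiff_comm ρ j p.2 p.1]
  field_simp
  ring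

theorem schurIntegrand_nonneg {ρ : ℝ} (h1 : -1 < ρ) (h2 : ρ ≤ 0) (j : Fin n)
    (g : EuclideanSpace ℝ (Fin n) → ℝ)
    (p : EuclideanSpace ℝ (Fin n) × EuclideanSpace ℝ (Fin n)) : 0 ≤ schurIntegrand ρ j g p := by
  -- Where the square cannot be completed, the kernel difference vanishes and the integrand with it.
  by_cases h : p.1 j * p.2 j = 0
  · simp only [schurIntegrand, schurMajorant, Prod.fst_swap, Prod.snd_swap]
    rw [reflectedKernelDiff_comm ρ j p.2 p.1, reflectedKernelDiff_eq_zero ρ h]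
    simp
  · rw [schurIntegrand_eq ρ j g (left_ne_zero_of_mul h) (right_ne_zero_of_mul h)]
    exact mul_nonneg (mul_reflectedKernelDiff_nonneg h1 h2 j _ _) (sq_nonneg _)

/-- Oddness turns the form with reflected kernel into -B(g), so the kernel difference integrates to
-2B(g); each of the two majorants contributes 2∫ w g². -/
theorem integrable_schurIntegrand {ρ : ℝ} (h1 : -1 < ρ) (h2 : ρ ≤ 0) (j : Fin n)
    {g : EuclideanSpace ℝ (Fin n) → ℝ} (hg : Measurable g) {C : ℝ} (hC : ∀ x, |g x| ≤ C)
    (hodd : ∀ x, g (coordReflection j x) = -g x) :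
    Integrable (schurIntegrand ρ j g) (volume.prod volume) ∧
      ∫ p, schurIntegrand ρ j g p ∂(volume.prod volume) = 4 * stabilityDeficit ρ g := by
  have hF := integrable_schurMajorant h1 h2 j hg hC
  have hB := integrable_mul_gaussianKernel h1 h2 (F := fun p => g p.1 * g p.2) (by fun_prop)
    (abs_mul_le_of_bound hC hC)
  have hB' : Integrable (fun p : EuclideanSpace ℝ (Fin n) × EuclideanSpace ℝ (Fin n) =>
      g p.1 * g p.2 * gaussianKernel ρ p.1 (coordReflection j p.2)) (volume.prod volume) := by
    have := ((LinearIsometryEquiv.refl ℝ (EuclideanSpace ℝ (Fin n))).measurePreserving.prod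
      (coordReflection j).measurePreserving).integrable_comp_of_integrable hB.neg
    refine this.congr (Filter.Eventually.of_forall fun p => ?_)
    simp [hodd]
  have hBI : ∫ p : EuclideanSpace ℝ (Fin n) × EuclideanSpace ℝ (Fin n),
      g p.1 * g p.2 * gaussianKernel ρ p.1 (coordReflection j p.2) ∂(volume.prod volume) =
      -∫ p : EuclideanSpace ℝ (Fin n) × EuclideanSpace ℝ (Fin n),
        g p.1 * g p.2 * gaussianKernel ρ p.1 p.2 ∂(volume.prod volume) := by
    rw [← integral_prod_comp_isometry (LinearIsometryEquiv.refl ℝ _) (coordReflection j),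
      ← integral_neg]
    simp [hodd]
  have hq : ∀ p : EuclideanSpace ℝ (Fin n) × EuclideanSpace ℝ (Fin n),
      g p.1 * g p.2 * reflectedKernelDiff ρ j p.1 p.2 =
      g p.1 * g p.2 * gaussianKernel ρ p.1 (coordReflection j p.2) -
      g p.1 * g p.2 * gaussianKernel ρ p.1 p.2 := fun p => by
    rw [reflectedKernelDiff, mul_sub]
  have hQ : Integrable (fun p : EuclideanSpace ℝ (Fin n) × EuclideanSpace ℝ (Fin n) =>
      g p.1 * g p.2 * reflectedKernelDiff ρ j p.1 p.2) (volume.prod volume) := by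
    simp_rw [hq]
    exact hB'.sub hB
  have hF' : Integrable (fun p => schurMajorant ρ j g p.swap) (volume.prod volume) := hF.swap
  have hsum : Integrable (fun p => schurMajorant ρ j g p + schurMajorant ρ j g p.swap)
      (volume.prod volume) := hF.add hF'
  refine ⟨hsum.sub (hQ.const_mul 2), ?_⟩
  unfold schurIntegrand
  rw [integral_sub hsum (hQ.const_mul 2), integral_add hF hF', integral_const_mul,
    integral_prod_swap (schurMajorant ρ j g), integral_schurMajorant h1 h2 j hg hC]
  simp_rw [hq]
  rw [integral_sub hB' hB, hBI, stabilityDeficit]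
  ring

theorem stabilityDeficit_of_odd {ρ : ℝ} (h1 : -1 < ρ) (h2 : ρ ≤ 0) (j : Fin n)
    {g : EuclideanSpace ℝ (Fin n) → ℝ} (hg : Measurable g) {C : ℝ} (hC : ∀ x, |g x| ≤ C)
    (hodd : ∀ x, g (coordReflection j x) = -g x) :
    0 ≤ stabilityDeficit ρ g ∧
      (ρ < 0 → stabilityDeficit ρ g = 0 → ∃ c : ℝ, ∀ᵐ x, g x = c * fOpt x j) := by
  obtain ⟨hint, heq⟩ := integrable_schurIntegrand h1 h2 j hg hC hodd
  have hnn := schurIntegrand_nonneg h1 h2 j g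
  refine ⟨by linarith [integral_nonneg (μ := volume.prod volume) (f := schurIntegrand ρ j g) hnn], fun h3 h0 => ?_⟩
  rw [h0, mul_zero, integral_eq_zero_iff_of_nonneg hnn hint] at heq
  -- A single generic x serves as base point: the ratio of g to the j-th coordinate of `fOpt` agrees
  -- with its value there at almost every y.
  obtain ⟨x, hx, hxj⟩ := ((Measure.ae_ae_of_ae_prod heq).and (ae_apply_ne_zero j)).exists
  refine ⟨g x / fOpt x j, ?_⟩
  filter_upwards [hx, ae_apply_ne_zero j] with y hy hyj
  rw [schurIntegrand_eq ρ j g hxj hyj] at hy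
  have h5 := fOpt_apply_ne_zero hyj
  have h4 := (mul_eq_zero.1 hy).resolve_left (mul_ne_zero (mul_ne_zero (fOpt_apply_ne_zero hxj) h5)
    (reflectedKernelDiff_ne_zero h1 h3 hxj hyj))
  have h6 := sub_eq_zero.1 (pow_eq_zero_iff two_ne_zero |>.1 h4)
  simp only at h6
  rw [h6]
  field_simp

/-! ### Even functions and the parity decomposition. -/

theorem stabilityDeficit_of_even (hn : 1 ≤ n) {ρ : ℝ} (h1 : -1 < ρ) (h2 : ρ ≤ 0)
    {g : EuclideanSpace ℝ (Fin n) → ℝ} (hg : Measurable g) {C : ℝ} (hC : ∀ x, |g x| ≤ C)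
    (heven : ∀ x, g (-x) = g x) :
    0 ≤ stabilityDeficit ρ g ∧ (ρ < 0 → stabilityDeficit ρ g = 0 → ∀ᵐ x, g x = 0) := by
  have hB := integral_correlatedGaussian_even_nonneg h1.le h2 hg hC heven
  rw [integral_correlatedGaussian h1 h2 (F := fun p => g p.1 * g p.2) (by fun_prop)] at hB
  have hN : 0 ≤ᵐ[volume] fun x => radialWeight ρ x * g x ^ 2 := by
    filter_upwards [ae_integrable_gaussianKernel h1 h2, ae_apply_ne_zero ⟨0, hn⟩] with x hx hj
    exact mul_nonneg (radialWeight_nonneg h1 h2 hx hj) (sq_nonneg _)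
  have hN' := integral_nonneg_of_ae hN
  unfold stabilityDeficit
  refine ⟨add_nonneg hB hN', fun h3 h0 => ?_⟩
  have h4 : ∫ x, radialWeight ρ x * g x ^ 2 = 0 := by linarith
  rw [integral_eq_zero_iff_of_nonneg_ae hN (integrable_radialWeight_mul_sq h1 h2 hg hC)] at h4
  filter_upwards [h4, ae_integrable_gaussianKernel h1 h2, ae_apply_ne_zero ⟨0, hn⟩] with x h5 hx hj
  simpa [(radialWeight_pos h1 h3 hx hj).ne'] using h5

/-- The cross terms change sign when all variables are reflected together, whereas the kernel and
the weight do not; hence they integrate to zero. -/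
theorem stabilityDeficit_add {ρ : ℝ} (h1 : -1 < ρ) (h2 : ρ ≤ 0) (j : Fin n)
    {g h : EuclideanSpace ℝ (Fin n) → ℝ} (hg : Measurable g) {C : ℝ} (hC : ∀ x, |g x| ≤ C)
    (hh : Measurable h) (hD : ∀ x, |h x| ≤ C)
    (heven : ∀ x, g (coordReflection j x) = g x) (hodd : ∀ x, h (coordReflection j x) = -h x) :
    stabilityDeficit ρ (fun x => g x + h x) = stabilityDeficit ρ g + stabilityDeficit ρ h := by
  have i1 := integrable_mul_gaussianKernel h1 h2 (F := fun p => g p.1 * g p.2) (by fun_prop)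
    (abs_mul_le_of_bound hC hC)
  have i2 := integrable_mul_gaussianKernel h1 h2 (F := fun p => h p.1 * h p.2) (by fun_prop)
    (abs_mul_le_of_bound hD hD)
  have i3 := integrable_mul_gaussianKernel h1 h2 (F := fun p => g p.1 * h p.2 + h p.1 * g p.2)
    (by fun_prop) (fun p => (abs_add_le _ _).trans
      (add_le_add (abs_mul_le_of_bound hC hD p) (abs_mul_le_of_bound hD hC p)))
  have h3 : ∫ p : EuclideanSpace ℝ (Fin n) × EuclideanSpace ℝ (Fin n),
      (g p.1 * h p.2 + h p.1 * g p.2) * gaussianKernel ρ p.1 p.2 ∂(volume.prod volume) = 0 := by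
    have := integral_prod_comp_isometry (coordReflection j) (coordReflection j) (fun p =>
      (g p.1 * h p.2 + h p.1 * g p.2) * gaussianKernel ρ p.1 p.2)
    simp only [heven, hodd, gaussianKernel_map] at this
    rw [← CharZero.eq_neg_self_iff, ← integral_neg]
    rw [← this]
    congr 1
    ext p
    ring
  have n1 := integrable_radialWeight_mul_sq h1 h2 hg hC
  have n2 := integrable_radialWeight_mul_sq h1 h2 hh hD
  have n3 : Integrable fun x => radialWeight ρ x * (2 * (g x * h x)) := by
    refine (integrable_radialWeight h1 h2).mul_bdd (c := 2 * (C * C)) (by fun_prop)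
      (Filter.Eventually.of_forall fun x => ?_)
    rw [Real.norm_eq_abs, abs_mul, abs_two]
    exact mul_le_mul_of_nonneg_left (abs_mul_le_of_bound hC hD (x, x)) two_pos.le
  have h4 : ∫ x, radialWeight ρ x * (2 * (g x * h x)) = 0 := by
    have := integral_comp_isometry (coordReflection j)
      (fun x => radialWeight ρ x * (2 * (g x * h x)))
    simp only [heven, hodd, radialWeight_map] at this
    rw [← CharZero.eq_neg_self_iff, ← integral_neg]
    rw [← this]
    congr 1
    ext p
    ring
  have e1 : ∀ p : EuclideanSpace ℝ (Fin n) × EuclideanSpace ℝ (Fin n),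
      (g p.1 + h p.1) * (g p.2 + h p.2) * gaussianKernel ρ p.1 p.2 =
      g p.1 * g p.2 * gaussianKernel ρ p.1 p.2 + h p.1 * h p.2 * gaussianKernel ρ p.1 p.2 +
      (g p.1 * h p.2 + h p.1 * g p.2) * gaussianKernel ρ p.1 p.2 := fun p => by ring
  have e2 : ∀ x, radialWeight ρ x * (g x + h x) ^ 2 = radialWeight ρ x * g x ^ 2 +
      radialWeight ρ x * h x ^ 2 + radialWeight ρ x * (2 * (g x * h x)) := fun x => by ring
  unfold stabilityDeficit
  simp_rw [e1, e2]
  have i12 : Integrable (fun p : EuclideanSpace ℝ (Fin n) × EuclideanSpace ℝ (Fin n) =>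
      g p.1 * g p.2 * gaussianKernel ρ p.1 p.2 + h p.1 * h p.2 * gaussianKernel ρ p.1 p.2)
      (volume.prod volume) := i1.add i2
  have n12 : Integrable fun x => radialWeight ρ x * g x ^ 2 + radialWeight ρ x * h x ^ 2 :=
    n1.add n2
  rw [integral_add i12 i3, integral_add n12 n3, h3, h4, integral_add i1 i2, integral_add n1 n2]
  ring

/-- The stability deficit of a bounded function is nonnegative, and vanishes only for linear
combinations of the coordinates of `fOpt`. -/
theorem stabilityDeficit_nonneg_aux (hn : 1 ≤ n) {ρ : ℝ} (h1 : -1 < ρ) (h2 : ρ ≤ 0) {C : ℝ}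
    (s : Finset (Fin n)) :
    ∀ g : EuclideanSpace ℝ (Fin n) → ℝ, Measurable g → (∀ x, |g x| ≤ C) →
      (∀ j ∉ s, ∀ x, g (coordReflection j x) = g x) →
      0 ≤ stabilityDeficit ρ g ∧ (ρ < 0 → stabilityDeficit ρ g = 0 →
        ∃ c : Fin n → ℝ, ∀ᵐ x, g x = ∑ j, c j * fOpt x j) := by
  induction s using Finset.induction_on with
  | empty =>
    intro g hg hC hs
    have h := stabilityDeficit_of_even hn h1 h2 hg hC
      (apply_neg_of_coordReflection_invariant fun j => hs j (Finset.notMem_empty j))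
    exact ⟨h.1, fun h3 h0 => ⟨0, by simpa using h.2 h3 h0⟩⟩
  | insert j s hj ih =>
    intro g hg hC hs
    have hR : Measurable (coordReflection j) := (coordReflection j).continuous.measurable
    have hCR : ∀ x, |g (coordReflection j x)| ≤ C := fun x => hC _
    set E : EuclideanSpace ℝ (Fin n) → ℝ := fun x => (g x + g (coordReflection j x)) / 2 with hE
    set O : EuclideanSpace ℝ (Fin n) → ℝ := fun x => (g x - g (coordReflection j x)) / 2 with hO
    have hEm : Measurable E := by fun_prop
    have hOm : Measurable O := by fun_prop
    have hEC : ∀ x, |E x| ≤ C := fun x => by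
      have h1 := abs_le.1 (hC x)
      have h2 := abs_le.1 (hCR x)
      exact abs_le.2 ⟨by simp only [hE]; linarith [h1.1, h2.1],
        by simp only [hE]; linarith [h1.2, h2.2]⟩
    have hOC : ∀ x, |O x| ≤ C := fun x => by
      have h1 := abs_le.1 (hC x)
      have h2 := abs_le.1 (hCR x)
      exact abs_le.2 ⟨by simp only [hO]; linarith [h1.1, h2.2],
        by simp only [hO]; linarith [h1.2, h2.1]⟩
    have hEe : ∀ x, E (coordReflection j x) = E x := fun x => by
      simp only [hE, coordReflection_coordReflection]; ring
    have hOo : ∀ x, O (coordReflection j x) = -O x := fun x => by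
      simp only [hO, coordReflection_coordReflection]; ring
    have hgEO : g = fun x => E x + O x := by
      ext x; simp only [hE, hO]; ring
    -- Reflections commute, so the even part keeps the invariances of g and gains the one in j.
    have hEs : ∀ i ∉ s, ∀ x, E (coordReflection i x) = E x := by
      intro i hi x
      by_cases hij : i = j
      · rw [hij, hEe]
      · have := hs i (by simp [hij, hi])
        simp only [hE]
        rw [coordReflection_comm j i, this, this]
    have hD := stabilityDeficit_add h1 h2 j hEm hEC hOm hOC hEe hOo
    rw [← hgEO] at hD
    have hE' := ih E hEm hEC hEs
    -- The odd part leaves the induction here: oddness in j alone suffices, whatever its behaviour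
    -- in the other coordinates.
    have hO' := stabilityDeficit_of_odd h1 h2 j hOm hOC hOo
    refine ⟨by linarith [hE'.1, hO'.1], fun h3 h0 => ?_⟩
    obtain ⟨c, hc⟩ := hE'.2 h3 (by linarith [hE'.1, hO'.1])
    obtain ⟨d, hd⟩ := hO'.2 h3 (by linarith [hE'.1, hO'.1])
    refine ⟨c + Pi.single j d, ?_⟩
    filter_upwards [hc, hd] with x hx hy
    rw [hgEO]
    simp only [hx, hy, Pi.add_apply, add_mul, Finset.sum_add_distrib]
    simp [Pi.single_apply]

theorem stabilityDeficit_nonneg (hn : 1 ≤ n) {ρ : ℝ} (h1 : -1 < ρ) (h2 : ρ ≤ 0)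
    {g : EuclideanSpace ℝ (Fin n) → ℝ} (hg : Measurable g) {C : ℝ} (hC : ∀ x, |g x| ≤ C) :
    0 ≤ stabilityDeficit ρ g :=
  (stabilityDeficit_nonneg_aux hn h1 h2 Finset.univ g hg hC (by simp)).1

theorem exists_eq_sum_fOpt_of_stabilityDeficit_eq_zero (hn : 1 ≤ n) {ρ : ℝ} (h1 : -1 < ρ)
    (h2 : ρ < 0) {g : EuclideanSpace ℝ (Fin n) → ℝ} (hg : Measurable g) {C : ℝ}
    (hC : ∀ x, |g x| ≤ C) (h0 : stabilityDeficit ρ g = 0) :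
    ∃ c : Fin n → ℝ, ∀ᵐ x, g x = ∑ j, c j * fOpt x j :=
  (stabilityDeficit_nonneg_aux hn h1 h2.le Finset.univ g hg hC (by simp)).2 h2 h0

/-! ### From scalar to vector-valued functions. -/

theorem noiseStability_eq_sum_stabilityDeficit {ρ : ℝ} (h1 : -1 < ρ) (h2 : ρ ≤ 0)
    {f : EuclideanSpace ℝ (Fin n) → EuclideanSpace ℝ (Fin n)} (hf : Measurable f)
    (hball : ∀ x, ‖f x‖ ≤ 1) :
    noiseStability ρ f =
      ∑ i, stabilityDeficit ρ (fun x => f x i) - ∫ x, radialWeight ρ x * ‖f x‖ ^ 2 := by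
  have hC : ∀ i x, |f x i| ≤ 1 := fun i x => (PiLp.norm_apply_le (f x) i).trans (hball x)
  have h3 : noiseStability ρ f = ∑ i,
      ∫ p : EuclideanSpace ℝ (Fin n) × EuclideanSpace ℝ (Fin n),
        f p.1 i * f p.2 i * gaussianKernel ρ p.1 p.2 ∂(volume.prod volume) := by
    rw [noiseStability, integral_correlatedGaussian h1 h2
      (F := fun p => inner ℝ (f p.1) (f p.2)) (by fun_prop), ← integral_finsetSum]
    · refine integral_congr_ae (Filter.Eventually.of_forall fun p => ?_)
      simp only [PiLp.inner_apply, Finset.sum_mul]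
      refine Finset.sum_congr rfl fun i _ => ?_
      simp [mul_comm]
    · exact fun i _ => integrable_mul_gaussianKernel h1 h2
        (F := fun p => f p.1 i * f p.2 i) (by fun_prop)
        (abs_mul_le_of_bound (g := fun x => f x i) (h := fun x => f x i) (hC i) (hC i))
  have h4 : ∫ x, radialWeight ρ x * ‖f x‖ ^ 2 = ∑ i, ∫ x, radialWeight ρ x * f x i ^ 2 := by
    rw [← integral_finsetSum]
    · simp_rw [EuclideanSpace.real_norm_sq_eq, Finset.mul_sum]
    · exact fun i _ => integrable_radialWeight_mul_sq h1 h2 (g := fun x => f x i) (by fun_prop)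
        (hC i)
  simp only [stabilityDeficit, Finset.sum_add_distrib]
  rw [h3, h4]
  ring

theorem noiseStability_fOpt {ρ : ℝ} (h1 : -1 < ρ) (h2 : ρ ≤ 0) :
    noiseStability ρ (fOpt (n := n)) = -∫ x : EuclideanSpace ℝ (Fin n), radialWeight ρ x := by
  rw [noiseStability, integral_correlatedGaussian h1 h2
    (F := fun p => inner ℝ (fOpt p.1) (fOpt p.2)) (by fun_prop), integral_prod _
      (integrable_mul_gaussianKernel h1 h2 (F := fun p => inner ℝ (fOpt p.1) (fOpt p.2))
        (by fun_prop) (fun p => abs_inner_fOpt_le p.1 p.2)), ← integral_neg]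
  simp [radialWeight]

theorem noiseStability_fOpt_le_of_neg_one (hn : 1 ≤ n)
    {f : EuclideanSpace ℝ (Fin n) → EuclideanSpace ℝ (Fin n)} (hf : Measurable f)
    (hball : ∀ x, ‖f x‖ ≤ 1) :
    noiseStability (-1) (fOpt (n := n)) ≤ noiseStability (-1) f := by
  have hbd : ∀ {φ : EuclideanSpace ℝ (Fin n) → EuclideanSpace ℝ (Fin n)}, (∀ x, ‖φ x‖ ≤ 1) →
      ∀ x y, |inner ℝ (φ x) (φ y)| ≤ 1 := fun h x y => (abs_real_inner_le_norm _ _).trans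
    (mul_le_one₀ (h x) (norm_nonneg _) (h y))
  unfold noiseStability
  -- At this degenerate correlation the pair is (x, -x), and the integrands can be compared
  -- pointwise by Cauchy–Schwarz.
  rw [correlatedGaussian_eq_map (a₁ := 1) (b₁ := 0) (a₂ := -1) (b₂ := 0) le_rfl (by norm_num)
    (by norm_num) (by norm_num) (by norm_num), integral_map (by fun_prop) (by fun_prop),
    integral_map (by fun_prop) (by fun_prop)]
  simp only [pairFst_gluePair, pairSnd_gluePair, one_smul, zero_smul, add_zero, neg_smul]
  refine integral_mono_ae ?_ ?_ ?_
  · exact Integrable.of_bound (by fun_prop) 1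
      (Filter.Eventually.of_forall fun p => hbd norm_fOpt_le _ _)
  · exact Integrable.of_bound (by fun_prop) 1
      (Filter.Eventually.of_forall fun p => hbd hball _ _)
  · have h0 : ∀ᵐ x ∂(stdGaussian (EuclideanSpace ℝ (Fin n))), x ≠ 0 := by
      rw [stdGaussian_eq_withDensity]
      refine withDensity_absolutelyContinuous _ _ |>.ae_le ?_
      filter_upwards [ae_apply_ne_zero (n := n) ⟨0, hn⟩] with x hx h
      simp [h] at hx
    filter_upwards [Measure.quasiMeasurePreserving_fst.ae h0] with p hp
    have h1 : fOpt (-p.1) = -fOpt p.1 := by simp [fOpt]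
    rw [h1, inner_neg_right, real_inner_self_eq_norm_sq, norm_fOpt hp]
    have := (abs_le.1 (hbd hball p.1 (-p.1))).1
    linarith

/-! ### The equality case and the conclusion. -/

theorem mem_orthogonalGroup_of_norm_map (A : Matrix (Fin n) (Fin n) ℝ)
    (h : ∀ x, ‖Matrix.toEuclideanLin A x‖ = ‖x‖) : A ∈ Matrix.orthogonalGroup (Fin n) ℝ := by
  rw [Matrix.mem_orthogonalGroup_iff']
  let L : EuclideanSpace ℝ (Fin n) →ₗᵢ[ℝ] EuclideanSpace ℝ (Fin n) :=
    ⟨Matrix.toEuclideanLin A, h⟩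
  ext i j
  have h3 := L.inner_map_map (EuclideanSpace.single i (1 : ℝ)) (EuclideanSpace.single j 1)
  have h4 : ∀ k l, L (EuclideanSpace.single k (1 : ℝ)) l = A l k := by
    intro k l
    simp [L, Matrix.toLpLin_apply]
  rw [PiLp.inner_apply] at h3
  simp only [h4] at h3
  simpa [Matrix.mul_apply, Matrix.one_apply, mul_comm, EuclideanSpace.inner_single_left,
    Pi.single_apply, eq_comm] using h3

theorem exists_orthogonal_of_eq_sum_fOpt {f : EuclideanSpace ℝ (Fin n) → EuclideanSpace ℝ (Fin n)}
    (c : Fin n → Fin n → ℝ) (hn : 1 ≤ n) (hc : ∀ i, ∀ᵐ x, f x i = ∑ j, c i j * fOpt x j)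
    (hnorm : ∀ᵐ x, ‖f x‖ = 1) :
    ∃ M ∈ Matrix.orthogonalGroup (Fin n) ℝ, ∀ᵐ x, f x = fOpt (Matrix.toEuclideanLin M x) := by
  set A := Matrix.of c with hA
  have hf : ∀ᵐ x, f x = Matrix.toEuclideanLin A (fOpt x) := by
    filter_upwards [ae_all_iff.2 hc] with x hx
    ext i
    rw [hx i]
    simp [hA, Matrix.toLpLin_apply, Matrix.mulVec, dotProduct]
  have hAn : (fun x => ‖Matrix.toEuclideanLin A x‖) =ᵐ[volume] fun x => ‖x‖ := by
    filter_upwards [hf, hnorm, ae_apply_ne_zero ⟨0, hn⟩] with x h3 h4 h5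
    have hx : x ≠ 0 := by rintro rfl; simp at h5
    rw [h3, fOpt, map_smul, norm_smul, norm_inv, norm_norm] at h4
    have := norm_ne_zero_iff.2 hx
    field_simp at h4
    exact h4
  -- Continuous functions that agree almost everywhere for Lebesgue measure agree everywhere, so the
  -- matrix is an isometry.
  have hA' := congrFun ((Continuous.ae_eq_iff_eq volume
    (LinearMap.continuous_of_finiteDimensional _).norm continuous_norm).1 hAn)
  refine ⟨A, mem_orthogonalGroup_of_norm_map A hA', ?_⟩
  filter_upwards [hf] with x hx
  rw [hx, fOpt, fOpt, map_smul, hA' x]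

theorem mainTheorem4 (n : ℕ) (hn : 1 ≤ n) (ρ : ℝ) (hρ₁ : -1 ≤ ρ) (hρ₀ : ρ ≤ 0)
    (f : EuclideanSpace ℝ (Fin n) → EuclideanSpace ℝ (Fin n)) (hf : Measurable f)
    (hball : ∀ x, f x ∈ Metric.closedBall (0 : EuclideanSpace ℝ (Fin n)) 1) :
    noiseStability ρ (fOpt (n := n)) ≤ noiseStability ρ f ∧
      (-1 < ρ → ρ < 0 → noiseStability ρ f = noiseStability ρ (fOpt (n := n)) →
        ∃ M ∈ Matrix.orthogonalGroup (Fin n) ℝ,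
          ∀ᵐ x ∂(stdGaussian (EuclideanSpace ℝ (Fin n))),
            f x = fOpt (Matrix.toEuclideanLin M x)) := by
  have hb : ∀ x, ‖f x‖ ≤ 1 := fun x => by simpa using hball x
  have hC : ∀ i x, |f x i| ≤ 1 := fun i x => (PiLp.norm_apply_le (f x) i).trans (hb x)
  rcases hρ₁.eq_or_lt with rfl | h1
  · exact ⟨noiseStability_fOpt_le_of_neg_one hn hf hb, fun h => absurd h (lt_irrefl _)⟩
  have hD : ∀ i, 0 ≤ stabilityDeficit ρ (fun x => f x i) := fun i =>
    stabilityDeficit_nonneg hn h1 hρ₀ (by fun_prop) (hC i)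
  have hDs := Finset.sum_nonneg fun i (_ : i ∈ Finset.univ) => hD i
  have hWf : Integrable fun x => radialWeight ρ x * ‖f x‖ ^ 2 := by
    refine (integrable_radialWeight h1 hρ₀).mul_bdd (c := 1) (by fun_prop)
      (Filter.Eventually.of_forall fun x => ?_)
    simpa using hb x
  have hint : Integrable fun x => radialWeight ρ x - radialWeight ρ x * ‖f x‖ ^ 2 :=
    (integrable_radialWeight h1 hρ₀).sub hWf
  have hI := integral_sub (integrable_radialWeight h1 hρ₀) hWf
  have hnn : 0 ≤ᵐ[volume] fun x => radialWeight ρ x - radialWeight ρ x * ‖f x‖ ^ 2 := by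
    filter_upwards [ae_integrable_gaussianKernel h1 hρ₀, ae_apply_ne_zero ⟨0, hn⟩] with x hx hj
    have := radialWeight_nonneg h1 hρ₀ hx hj
    have h3 : ‖f x‖ ^ 2 ≤ 1 := pow_le_one₀ (norm_nonneg _) (hb x)
    simp only [Pi.zero_apply]
    nlinarith
  have hI0 := integral_nonneg_of_ae hnn
  -- The gap between the two stabilities is now the sum of the deficits plus ∫ w(1 - ‖f‖²), all
  -- nonnegative; equality makes each vanish.
  rw [noiseStability_eq_sum_stabilityDeficit h1 hρ₀ hf hb, noiseStability_fOpt h1 hρ₀]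
  refine ⟨by linarith, fun _ h2 heq => ?_⟩
  have hD0 : ∀ i, stabilityDeficit ρ (fun x => f x i) = 0 := fun i =>
    (Finset.sum_eq_zero_iff_of_nonneg fun i _ => hD i).1 (by linarith) i (Finset.mem_univ i)
  have hI' : ∫ x, (radialWeight ρ x - radialWeight ρ x * ‖f x‖ ^ 2) = 0 := by linarith
  rw [integral_eq_zero_iff_of_nonneg_ae hnn hint] at hI'
  have hnorm : ∀ᵐ x, ‖f x‖ = 1 := by
    filter_upwards [hI', ae_integrable_gaussianKernel h1 hρ₀, ae_apply_ne_zero ⟨0, hn⟩]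
      with x h3 hx hj
    have h4 := radialWeight_pos h1 h2 hx hj
    have h5 : radialWeight ρ x * (1 - ‖f x‖ ^ 2) = 0 := by
      simp only [Pi.zero_apply] at h3
      linarith
    have h6 := (mul_eq_zero.1 h5).resolve_left h4.ne'
    exact (pow_eq_one_iff_of_nonneg (norm_nonneg _) two_ne_zero).1 (by linarith)
  choose c hc using fun i => exists_eq_sum_fOpt_of_stabilityDeficit_eq_zero hn h1 h2
    (g := fun x => f x i) (by fun_prop) (hC i) (hD0 i)
  obtain ⟨M, hM, hfM⟩ := exists_orthogonal_of_eq_sum_fOpt c hn hc hnorm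
  refine ⟨M, hM, ?_⟩
  rw [stdGaussian_eq_withDensity]
  exact (withDensity_absolutelyContinuous _ _).ae_le hfM
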